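/- Let $n\in\{2,3\}$, let $\Omega\subset\mathbb{R}^n$ be a nonempty, convex, open and bounded domain, and let $\kappa,\tau>0$. There is a constant $C>0$, depending only on $n,\Omega,\kappa,\tau$, such that the following holds for every finite nonempty conforming triangulation $\mathcal{T}_h$ into $n$-simplices such that $\Omega_h:=\operatorname{int}\bigcup_{T\in\mathcal{T}_h}T\subset\Omega$ and such that $\rho_T/\sigma_T\le\kappa$ and $h/\rho_T\le\tau$ for all $T\in\mathcal{T}_h$, where $\rho_T$ is the diameter of $T$, $\sigma_T$ the diameter of the largest ball contained in $T$, and $h=\max_T\rho_T$ the mesh size. Let $x_1,\dots,x_{N_h}$ be the vertices of $\mathcal{T}_h$ and let $\phi_i$ be the nodal basis functions, that is, $\phi_i$ is continuous on $\overline{\Omega}_h$, affine on each $T\in\mathcal{T}_h$, and $\phi_i(x_j)=\delta_{ij}$. Let $$M_h=\Big(\int_{\Omega_h}\phi_i\phi_j\,dx\Big)_{i,j=1}^{N_h},\qquad W_h=\operatorname{diag}\Big(\int_{\Omega_h}\phi_i\,dx\Big)_{i=1}^{N_h}$$ be the mass matrix and the lumped mass matrix, and write $\|\mathbf z\|_A^2=\mathbf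 z^{T}A\mathbf z$ and $\|\mathbf v\|_1=\sum_i|v_i|$. Then for every $\mathbf z=(z_1,\dots,z_{N_h})\in\mathbb{R}^{N_h}$ and $z_h=\sum_{i=1}^{N_h}z_i\phi_i$, $$0\le\|\mathbf z\|_{W_h}^2-\|\mathbf z\|_{M_h}^2\le C\,\|z_h^2\|_{H^2}\,h^2,$$ $$0\le\|W_h\mathbf z\|_1-\int_{\Omega_h}|z_h|\,dx\le C\,\|z_h\|_{H^1(\Omega_h)}\,h .$$ Here $\|z_h^2\|_{H^2}=\big(\sum_{T\in\mathcal{T}_h}\|z_h^2\|_{H^2(\operatorname{int}T)}^2\big)^{1/2}$ is the piecewise $H^2$ norm; the first estimate holds also with the norm of $H^2(\Omega_h)$, read as $+\infty$ if $z_h^2\notin H^2(\Omega_h)$. -/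

import Mathlib

open MeasureTheory Set
open scoped ENNReal ContDiff Matrix

noncomputable section

namespace LumpedMass

/-- `ℝⁿ` with the Euclidean norm. -/
abbrev Rn (n : ℕ) : Type := EuclideanSpace ℝ (Fin n)

/-! ### Sobolev norms through weak derivatives -/

/-- On the open set `U`, the function `g` is a weak partial derivative of `f` in direction `i`. -/
def IsWeakPartial {n : ℕ} (U : Set (Rn n)) (i : Fin n) (f g : Rn n → ℝ) : Prop :=
  LocallyIntegrableOn f U volume ∧ LocallyIntegrableOn g U volume ∧
    ∀ ψ : Rn n → ℝ, ContDiff ℝ ∞ ψ → HasCompactSupport ψ → tsupport ψ ⊆ U →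
      ∫ x in U, f x * fderiv ℝ ψ x (EuclideanSpace.single i 1) = -∫ x in U, g x * ψ x

/-- The square of the `L²(U)` norm, with values in `[0, ∞]`. -/
def l2NormSq {n : ℕ} (U : Set (Rn n)) (f : Rn n → ℝ) : ℝ≥0∞ :=
  eLpNorm f 2 (volume.restrict U) ^ 2

/-- The `H¹(U)` norm with values in `[0, ∞]`; it is `∞` if `f ∉ H¹(U)`. Weak derivatives are unique
up to null sets, so the infimum runs over at most one value. -/
def h1Norm {n : ℕ} (U : Set (Rn n)) (f : Rn n → ℝ) : ℝ≥0∞ :=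
  ⨅ (g : Fin n → Rn n → ℝ) (_ : ∀ i, IsWeakPartial U i f (g i)),
    (l2NormSq U f + ∑ i, l2NormSq U (g i)) ^ (1 / 2 : ℝ)

/-- The `H²(U)` norm with values in `[0, ∞]`; it is `∞` if `f ∉ H²(U)`. -/
def h2Norm {n : ℕ} (U : Set (Rn n)) (f : Rn n → ℝ) : ℝ≥0∞ :=
  ⨅ (g : Fin n → Rn n → ℝ) (_ : ∀ i, IsWeakPartial U i f (g i))
    (H : Fin n → Fin n → Rn n → ℝ) (_ : ∀ i j, IsWeakPartial U j (g i) (H i j)),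
    (l2NormSq U f + ∑ i, l2NormSq U (g i) + ∑ i, ∑ j, l2NormSq U (H i j)) ^ (1 / 2 : ℝ)

/-! ### Triangulations -/

/-- A conforming triangulation in `ℝⁿ`: a finite, nonempty simplicial complex in which every
simplex is a face of an `n`-dimensional simplex. -/
structure Triangulation (n : ℕ) extends Geometry.SimplicialComplex ℝ (Rn n) where
  finite_faces : faces.Finite
  nonempty_faces : faces.Nonempty
  pure_faces : ∀ s ∈ faces, ∃ t ∈ faces, s ⊆ t ∧ t.card = n + 1

namespace Triangulation

variable {n : ℕ} (K : Triangulation n)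

/-- The cells, each given by its `n + 1` vertices; the cell itself is the convex hull. -/
def cells : Finset (Finset (Rn n)) :=
  K.finite_faces.toFinset.filter (fun s => s.card = n + 1)

/-- The nodes `x_i`: all vertices of the triangulation. -/
abbrev Node : Type := ↥K.toSimplicialComplex.vertices

instance : Fintype K.Node :=
  (K.finite_faces.preimage (Finset.singleton_injective.injOn)).fintype

/-- The discrete domain `Ω_h`: the interior of the union of all cells. -/
def domain : Set (Rn n) := interior K.toSimplicialComplex.space

/-- The diameter `ρ_T` of a cell. -/
def rho (s : Finset (Rn n)) : ℝ := Metric.diam (convexHull ℝ (s : Set (Rn n)))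

/-- The diameter `σ_T` of the largest ball contained in a cell. -/
def sigma (s : Finset (Rn n)) : ℝ :=
  sSup {d : ℝ | ∃ (c : Rn n) (r : ℝ), 0 ≤ r ∧ d = 2 * r ∧
    Metric.closedBall c r ⊆ convexHull ℝ (s : Set (Rn n))}

/-- The mesh size `h = max_T ρ_T`. -/
def meshSize : ℝ := ⨆ s : K.cells, rho s.1

/-- Regularity and quasi-uniformity with constants `κ` and `τ`. -/
def IsRegularQuasiUniform (κ τ : ℝ) : Prop :=
  ∀ s ∈ K.cells, rho s / sigma s ≤ κ ∧ K.meshSize / rho s ≤ τ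

/-- `w` is the family of barycentric coordinates of `x` in the triangulation: nonnegative weights of
sum `1`, supported on the vertices of one simplex, with barycentre `x`. -/
def IsBarycentric (x : Rn n) (w : Rn n → ℝ) : Prop :=
  ∃ s ∈ K.faces, (∀ v, 0 ≤ w v) ∧ (∀ v ∉ s, w v = 0) ∧ ∑ v ∈ s, w v = 1 ∧ ∑ v ∈ s, w v • v = x

theorem exists_isBarycentric {x : Rn n} {s : Finset (Rn n)} (hs : s ∈ K.faces)
    (hx : x ∈ convexHull ℝ (s : Set (Rn n))) :
    ∃ w, K.IsBarycentric x w ∧ ∀ v ∉ s, w v = 0 := by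
  classical
  rw [Finset.convexHull_eq] at hx
  obtain ⟨w, h0, h1, h2⟩ := hx
  rw [Finset.centerMass_eq_of_sum_1 _ _ h1] at h2
  refine ⟨fun v => if v ∈ s then w v else 0, ⟨s, hs, ?_, ?_, ?_, ?_⟩, ?_⟩
  · intro v
    by_cases hv : v ∈ s
    · simpa [hv] using h0 v hv
    · simp [hv]
  · intro v hv; simp [hv]
  · rw [← h1]; exact Finset.sum_congr rfl fun v hv => by simp [hv]
  · rw [← h2]; exact Finset.sum_congr rfl fun v hv => by simp [hv]
  · intro v hv; simp [hv]

/-- Barycentric coordinates are unique, also when a point lies in several simplices. -/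
theorem IsBarycentric.unique {x : Rn n} {w w' : Rn n → ℝ}
    (h : K.IsBarycentric x w) (h' : K.IsBarycentric x w') : w = w' := by
  classical
  have key : ∀ {u u' : Rn n → ℝ} {s : Finset (Rn n)}, s ∈ K.faces →
      (∀ v ∉ s, u v = 0) → (∀ v ∉ s, u' v = 0) → ∑ v ∈ s, u v = ∑ v ∈ s, u' v →
      ∑ v ∈ s, u v • v = ∑ v ∈ s, u' v • v → u = u' := by
    intro u u' s hs h0 h0' h1 h2
    funext v
    by_cases hv : v ∈ s
    · exact (K.indep hs).eq_of_sum_eq_sum_subtype h1 h2 v hv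
    · rw [h0 v hv, h0' v hv]
  have mem : ∀ {u : Rn n → ℝ} {s : Finset (Rn n)}, (∀ v, 0 ≤ u v) → ∑ v ∈ s, u v = 1 →
      ∑ v ∈ s, u v • v = x → x ∈ convexHull ℝ (s : Set (Rn n)) := by
    intro u s h0 h1 h2
    rw [Finset.convexHull_eq]
    exact ⟨u, fun v _ => h0 v, h1, by rw [Finset.centerMass_eq_of_sum_1 _ _ h1]; exact h2⟩
  obtain ⟨s, hs, p0, pz, p1, p2⟩ := h
  obtain ⟨t, ht, q0, qz, q1, q2⟩ := h'
  have hx : x ∈ convexHull ℝ ((s ∩ t : Finset (Rn n)) : Set (Rn n)) := by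
    rw [Finset.coe_inter]
    exact K.inter_subset_convexHull hs ht ⟨mem p0 p1 p2, mem q0 q1 q2⟩
  have hne : (s ∩ t).Nonempty := by
    exact Finset.coe_nonempty.1 (convexHull_nonempty_iff.1 ⟨x, hx⟩)
  have hst : s ∩ t ∈ K.faces := K.down_closed hs Finset.inter_subset_left hne
  obtain ⟨u, ⟨r, hr, r0, rz, r1, r2⟩, uz⟩ := K.exists_isBarycentric hst hx
  have ext : ∀ {a : Finset (Rn n)}, s ∩ t ⊆ a →
      ∑ v ∈ a, u v = 1 ∧ ∑ v ∈ a, u v • v = x := by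
    intro a ha
    have e1 : ∀ b : Finset (Rn n), (∀ v ∉ b, u v = 0) → ∑ v ∈ b, u v = ∑ v ∈ b ∪ a ∪ r, u v :=
      fun b hb => Finset.sum_subset (by intro v; simp; tauto) (fun v _ hv => hb v hv)
    have e2 : ∀ b : Finset (Rn n), (∀ v ∉ b, u v = 0) →
        ∑ v ∈ b, u v • v = ∑ v ∈ b ∪ a ∪ r, u v • v :=
      fun b hb => Finset.sum_subset (by intro v; simp; tauto) (fun v _ hv => by simp [hb v hv])
    have az : ∀ v ∉ a, u v = 0 := fun v hv => uz v (fun h => hv (ha h))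
    have c : r ∪ a ∪ r = a ∪ a ∪ r := by ext v; simp; tauto
    exact ⟨by rw [e1 a az, ← c, ← e1 r rz, r1], by rw [e2 a az, ← c, ← e2 r rz, r2]⟩
  have hs' := ext (a := s) Finset.inter_subset_left
  have ht' := ext (a := t) Finset.inter_subset_right
  have uzs : ∀ v ∉ s, u v = 0 := fun v hv => uz v (fun h => hv (Finset.mem_inter.1 h).1)
  have uzt : ∀ v ∉ t, u v = 0 := fun v hv => uz v (fun h => hv (Finset.mem_inter.1 h).2)
  exact (key hs pz uzs (p1.trans hs'.1.symm) (p2.trans hs'.2.symm)).trans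
    (key ht uzt qz (ht'.1.trans q1.symm) (ht'.2.trans q2.symm))

open Classical in
/-- The nodal basis function `φ_i`: at a point of the triangulated set it is the barycentric
coordinate belonging to the node `i`. Equivalently, it is the continuous function that is affine on
each cell, `1` at the node `i` and `0` at the other nodes. It is `0` off the triangulated set. -/
def nodal (i : K.Node) (x : Rn n) : ℝ :=
  if h : ∃ w, K.IsBarycentric x w then h.choose i else 0

/-- The finite element function `z_h = ∑ i, z_i φ_i`. -/
def fe (z : K.Node → ℝ) (x : Rn n) : ℝ := ∑ i, z i * K.nodal i x

/-- The mass matrix `M_h`. -/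
def massMatrix : Matrix K.Node K.Node ℝ :=
  Matrix.of fun i j => ∫ x in K.domain, K.nodal i x * K.nodal j x

open Classical in
/-- The lumped mass matrix `W_h`. -/
def lumpedMassMatrix : Matrix K.Node K.Node ℝ :=
  Matrix.diagonal fun i => ∫ x in K.domain, K.nodal i x

/-- The piecewise `H²` norm: the square root of `∑_T ‖f‖²_{H²(T)}`. -/
def brokenH2Norm (f : Rn n → ℝ) : ℝ≥0∞ :=
  (∑ s ∈ K.cells, h2Norm (interior (convexHull ℝ (s : Set (Rn n)))) f ^ 2) ^ (1 / 2 : ℝ)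

end Triangulation

/-- `‖z‖²_A = zᵀ A z`. -/
def matNormSq {ι : Type} [Fintype ι] (A : Matrix ι ι ℝ) (z : ι → ℝ) : ℝ := z ⬝ᵥ (A *ᵥ z)

/-- The `ℓ¹` norm of a vector. -/
def l1Norm {ι : Type} [Fintype ι] (v : ι → ℝ) : ℝ := ∑ i, |v i|

end LumpedMass

end

/-! At each point `x` of the discrete domain the values `φ_i(x)` are nonnegative and sum to 1, so
they form a probability distribution on the nodes, and `z_h(x)` is the mean of the `z_i`. Both
lumping errors are therefore integrals of Jensen gaps: `∑ z_i² φ_i - z_h²` is a variance, and `∑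
|z_i| φ_i - |z_h|` lies between 0 and the mean absolute deviation.

On a cell `z_h(x) = a x + b`, and only the vertices of that cell carry weight. Each lies within `h`
of `x`, so the gaps are at most `‖a‖² h²` and `‖a‖ h`. There `∂_i z_h = a_i` and `∂_i ∂_i (z_h²) = 2
a_i²`, hence `‖a‖ ≤ ∑ |∂_i z_h|` and `‖a‖² ≤ ∑ |∂_i ∂_i (z_h²)|`. Integration and Cauchy–Schwarz
give the Sobolev norms, with factor `n |Ω_h|^{1/2}`.

The norms are infima over weak derivatives, so the bounds are proved for every admissible family;
`IsWeakPartial.ae_eq_fderiv` identifies its members with the classical derivatives inside cells. An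
arbitrary open `V` inside the discrete domain is allowed: the whole domain gives the global norms,
while cell interiors and a discrete Cauchy–Schwarz inequality give the broken norm. -/

namespace LumpedMass

namespace Triangulation

variable {n : ℕ} (K : Triangulation n)

/-! ### Nodal functions as barycentric coordinates -/

theorem mem_cells {s : Finset (Rn n)} : s ∈ K.cells ↔ s ∈ K.faces ∧ s.card = n + 1 := by
  simp [cells]

theorem mem_vertices {s : Finset (Rn n)} (hs : s ∈ K.faces) {v : Rn n} (hv : v ∈ s) :
    v ∈ K.toSimplicialComplex.vertices :=
  K.down_closed hs (Finset.singleton_subset_iff.2 hv) (Finset.singleton_nonempty v)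

theorem nodal_eq {x : Rn n} {w : Rn n → ℝ} (hw : K.IsBarycentric x w) (i : K.Node) :
    K.nodal i x = w i := by
  have h : ∃ w, K.IsBarycentric x w := ⟨w, hw⟩
  rw [nodal, dif_pos h, h.choose_spec.unique K hw]

theorem nodal_nonneg (i : K.Node) (x : Rn n) : 0 ≤ K.nodal i x := by
  by_cases h : ∃ w, K.IsBarycentric x w
  · obtain ⟨w, hw⟩ := h
    rw [K.nodal_eq hw]
    obtain ⟨s, -, h0, -⟩ := hw
    exact h0 i
  · rw [nodal, dif_neg h]

theorem nodal_eq_zero_of_notMem {s : Finset (Rn n)} (hs : s ∈ K.faces) {x : Rn n}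
    (hx : x ∈ convexHull ℝ (s : Set (Rn n))) (i : K.Node) (hi : (i : Rn n) ∉ s) :
    K.nodal i x = 0 := by
  obtain ⟨w, hw, h0⟩ := K.exists_isBarycentric hs hx
  rw [K.nodal_eq hw, h0 _ hi]

theorem sum_node_eq {f : Rn n → ℝ} {s : Finset (Rn n)} (hs : s ∈ K.faces)
    (hf : ∀ v ∉ s, f v = 0) : ∑ i : K.Node, f i = ∑ v ∈ s, f v := by
  classical
  have hfin : K.toSimplicialComplex.vertices.Finite := Set.toFinite _
  rw [← Finset.sum_subtype hfin.toFinset (fun x => hfin.mem_toFinset) f]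
  exact (Finset.sum_subset (fun v hv => hfin.mem_toFinset.2 (K.mem_vertices hs hv))
    (fun v _ hv => hf v hv)).symm

theorem sum_nodal {s : Finset (Rn n)} (hs : s ∈ K.faces) {x : Rn n}
    (hx : x ∈ convexHull ℝ (s : Set (Rn n))) : ∑ i, K.nodal i x = 1 := by
  obtain ⟨w, hw, -⟩ := K.exists_isBarycentric hs hx
  simp_rw [K.nodal_eq hw]
  obtain ⟨t, ht, -, h0, h1, -⟩ := hw
  rw [K.sum_node_eq ht h0, h1]

theorem nodal_node (i j : K.Node) [Decidable (i = j)] :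
    K.nodal i (j : Rn n) = if i = j then 1 else 0 := by
  classical
  have hw : K.IsBarycentric (j : Rn n) (Pi.single (j : Rn n) 1) := by
    refine ⟨{(j : Rn n)}, j.2, fun v => ?_, fun v hv => ?_, by simp, by simp⟩
    · by_cases h : v = j
      · subst h; simp
      · simp [Pi.single_eq_of_ne h]
    · exact Pi.single_eq_of_ne (by simpa using hv) _
  rw [K.nodal_eq hw, Pi.single_apply]
  exact if_congr Subtype.coe_inj rfl rfl

theorem fe_node (z : K.Node → ℝ) (j : K.Node) : K.fe z (j : Rn n) = z j := by
  classical
  simp [fe, nodal_node]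

/-- The barycentric coordinates of a cell are affine. -/
theorem exists_nodal_eq_affine {s : Finset (Rn n)} (hs : s ∈ K.cells) (i : K.Node) :
    ∃ (a : Rn n →L[ℝ] ℝ) (b : ℝ), ∀ x ∈ convexHull ℝ (s : Set (Rn n)), K.nodal i x = a x + b := by
  classical
  obtain ⟨hf, hc⟩ := K.mem_cells.1 hs
  by_cases hi : (i : Rn n) ∈ s
  swap
  · exact ⟨0, 0, fun x hx => by simp [K.nodal_eq_zero_of_notMem hf hx i hi]⟩
  have ind := K.indep hf
  -- The `n + 1` affinely independent vertices of a cell span the whole space.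
  let B : AffineBasis s ℝ (Rn n) := ⟨fun v => v, ind,
    ind.affineSpan_eq_top_iff_card_eq_finrank_add_one.2 (by simp [hc])⟩
  let L := B.coord ⟨i, hi⟩
  refine ⟨L.linear.toContinuousLinearMap, L 0, fun x hx => ?_⟩
  have hx' : ∀ v, 0 ≤ B.coord v x := by
    have : range B = (s : Set (Rn n)) := Subtype.range_coe
    rw [← this, B.convexHull_eq_nonneg_coord] at hx
    exact hx
  have hw : K.IsBarycentric x (fun v => if h : v ∈ s then B.coord ⟨v, h⟩ x else 0) := by
    refine ⟨s, hf, fun v => ?_, fun v hv => dif_neg hv, ?_, ?_⟩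
    · dsimp only
      split_ifs with h
      exacts [hx' _, le_rfl]
    · rw [← Finset.sum_coe_sort, ← B.sum_coord_apply_eq_one x]
      exact Finset.sum_congr rfl fun v _ => by simp
    · rw [← Finset.sum_coe_sort]
      conv_rhs => rw [← B.linear_combination_coord_eq_self x]
      exact Finset.sum_congr rfl fun v _ => by simp; rfl
  rw [K.nodal_eq hw]
  simp only [hi, dif_pos]
  exact congrFun L.decomp x

theorem exists_fe_eq_affine {s : Finset (Rn n)} (hs : s ∈ K.cells) (z : K.Node → ℝ) :
    ∃ (a : Rn n →L[ℝ] ℝ) (b : ℝ), ∀ x ∈ convexHull ℝ (s : Set (Rn n)), K.fe z x = a x + b := by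
  choose a b hab using fun i => K.exists_nodal_eq_affine hs i
  refine ⟨∑ i, z i • a i, ∑ i, z i * b i, fun x hx => ?_⟩
  simp only [fe, hab _ x hx, mul_add, Finset.sum_add_distrib, sum_apply,
    smul_apply, smul_eq_mul]

/-! ### Geometry of the cells -/

theorem space_eq_iUnion_cells :
    K.toSimplicialComplex.space = ⋃ s ∈ K.cells, convexHull ℝ (s : Set (Rn n)) := by
  apply Subset.antisymm
  · refine iUnion₂_subset fun s hs => ?_
    obtain ⟨t, ht, hst, hc⟩ := K.pure_faces s hs
    exact (convexHull_mono (Finset.coe_subset.2 hst)).trans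
      (subset_biUnion_of_mem (u := fun t : Finset (Rn n) => convexHull ℝ (t : Set (Rn n)))
        (K.mem_cells.2 ⟨ht, hc⟩))
  · exact iUnion₂_subset fun s hs =>
      Geometry.SimplicialComplex.convexHull_subset_space (K.mem_cells.1 hs).1

theorem isCompact_space : IsCompact K.toSimplicialComplex.space := by
  rw [space_eq_iUnion_cells]
  exact K.cells.isCompact_biUnion fun s _ => s.finite_toSet.isCompact_convexHull ℝ

/-- The cells form a finite closed cover, and the function is affine on each. -/
theorem continuousOn_nodal (i : K.Node) :
    ContinuousOn (K.nodal i) K.toSimplicialComplex.space := by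
  have h : K.toSimplicialComplex.space =
      ⋃ s : K.cells, convexHull ℝ ((s : Finset (Rn n)) : Set (Rn n)) := by
    rw [space_eq_iUnion_cells]
    exact biUnion_eq_iUnion (K.cells : Set (Finset (Rn n)))
      fun s _ => convexHull ℝ (s : Set (Rn n))
  rw [h]
  refine (locallyFinite_of_finite _).continuousOn_iUnion
    (fun s => s.1.finite_toSet.isClosed_convexHull ℝ) fun s => ?_
  obtain ⟨a, b, hab⟩ := K.exists_nodal_eq_affine s.2 i
  exact (a.continuous.add continuous_const).continuousOn.congr hab

theorem continuousOn_fe (z : K.Node → ℝ) : ContinuousOn (K.fe z) K.toSimplicialComplex.space :=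
  continuousOn_finsetSum _ fun i _ => continuousOn_const.mul (K.continuousOn_nodal i)

theorem integrableOn_domain {f : Rn n → ℝ} (hf : ContinuousOn f K.toSimplicialComplex.space) :
    IntegrableOn f K.domain :=
  (hf.integrableOn_compact K.isCompact_space).mono_set interior_subset

theorem interior_cell_subset_domain {s : Finset (Rn n)} (hs : s ∈ K.cells) :
    interior (convexHull ℝ (s : Set (Rn n))) ⊆ K.domain :=
  interior_mono (Geometry.SimplicialComplex.convexHull_subset_space (K.mem_cells.1 hs).1)

theorem exists_mem_cell {x : Rn n} (hx : x ∈ K.domain) :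
    ∃ s ∈ K.cells, x ∈ convexHull ℝ (s : Set (Rn n)) := by
  have := interior_subset hx
  rw [space_eq_iUnion_cells] at this
  simpa using this

/-- Almost every point of the discrete domain is interior to a cell. -/
theorem ae_exists_mem_interior_cell :
    ∀ᵐ x : Rn n, x ∈ K.domain → ∃ s ∈ K.cells, x ∈ interior (convexHull ℝ (s : Set (Rn n))) := by
  -- Cells are convex, so their frontiers are null, and there are finitely many of them.
  have h : ∀ᵐ x : Rn n, ∀ s ∈ K.cells, x ∉ frontier (convexHull ℝ (s : Set (Rn n))) := by
    rw [Finset.eventually_all]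
    intro s _
    exact measure_eq_zero_iff_ae_notMem.1 ((convex_convexHull ℝ _).addHaar_frontier volume)
  filter_upwards [h] with x hx hxd
  obtain ⟨s, hs, hxs⟩ := K.exists_mem_cell hxd
  refine ⟨s, hs, by_contra fun hxi => hx s hs ⟨subset_closure hxs, hxi⟩⟩

/-- By conformity, the intersection of two cells lies in the hull of their common vertices. If the
interiors meet, this hull has interior points, so the common vertices span the space; there are then
`n + 1` of them and the cells coincide. -/
theorem pairwiseDisjoint_interior_cells :
    (K.cells : Set (Finset (Rn n))).PairwiseDisjoint
      fun s => interior (convexHull ℝ (s : Set (Rn n))) := by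
  classical
  intro s hs t ht hst
  obtain ⟨hs, hsc⟩ := K.mem_cells.1 hs
  obtain ⟨ht, htc⟩ := K.mem_cells.1 ht
  refine disjoint_left.2 fun x hxs hxt => hst ?_
  have hx : x ∈ interior (convexHull ℝ ((s ∩ t : Finset (Rn n)) : Set (Rn n))) := by
    rw [Finset.coe_inter]
    refine interior_mono (K.inter_subset_convexHull hs ht) ?_
    rw [interior_inter]
    exact ⟨hxs, hxt⟩
  have hspan := interior_convexHull_nonempty_iff_affineSpan_eq_top.1 ⟨x, hx⟩
  have hne : (s ∩ t).Nonempty :=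
    Finset.coe_nonempty.1 (convexHull_nonempty_iff.1 ⟨x, interior_subset hx⟩)
  have ind := K.indep (K.down_closed hs Finset.inter_subset_left hne)
  have hcard := ind.affineSpan_eq_top_iff_card_eq_finrank_add_one.1
    (by rw [Subtype.range_coe]; exact hspan)
  simp only [Fintype.card_coe, finrank_euclideanSpace, Fintype.card_fin] at hcard
  exact (Finset.eq_of_subset_of_card_le Finset.inter_subset_left (by omega)).symm.trans
    (Finset.eq_of_subset_of_card_le Finset.inter_subset_right (by omega))

/-! ### Pointwise bounds for the Jensen gaps -/

theorem dist_le_meshSize {s : Finset (Rn n)} (hs : s ∈ K.cells) {x y : Rn n}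
    (hx : x ∈ convexHull ℝ (s : Set (Rn n))) (hy : y ∈ convexHull ℝ (s : Set (Rn n))) :
    dist x y ≤ K.meshSize :=
  (Metric.dist_le_diam_of_mem (s.finite_toSet.isCompact_convexHull ℝ).isBounded hx hy).trans
    (le_ciSup (f := fun t : K.cells => rho t.1) (Set.finite_range _).bddAbove ⟨s, hs⟩)

theorem meshSize_nonneg : 0 ≤ K.meshSize :=
  Real.iSup_nonneg fun _ => Metric.diam_nonneg

theorem abs_node_sub_fe_le {s : Finset (Rn n)} (hs : s ∈ K.cells) (z : K.Node → ℝ)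
    {a : Rn n →L[ℝ] ℝ} {b : ℝ} (hab : ∀ x ∈ convexHull ℝ (s : Set (Rn n)), K.fe z x = a x + b)
    {x : Rn n} (hx : x ∈ convexHull ℝ (s : Set (Rn n))) (i : K.Node) (hi : (i : Rn n) ∈ s) :
    |z i - K.fe z x| ≤ ‖a‖ * K.meshSize := by
  have hi' := subset_convexHull ℝ (s : Set (Rn n)) hi
  rw [← K.fe_node z i, hab _ hi', hab _ hx, add_sub_add_right_eq_sub, ← map_sub]
  refine (a.le_opNorm _).trans ?_
  rw [← dist_eq_norm]
  exact mul_le_mul_of_nonneg_left (K.dist_le_meshSize hs hi' hx) (norm_nonneg _)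

/-- A weighted mean at a point of a cell sees only the vertices of that cell, so a bound at those
vertices suffices. -/
theorem sum_nodal_mul_le {s : Finset (Rn n)} (hs : s ∈ K.cells) {x : Rn n}
    (hx : x ∈ convexHull ℝ (s : Set (Rn n))) {f : K.Node → ℝ} {c : ℝ}
    (hf : ∀ i : K.Node, (i : Rn n) ∈ s → f i ≤ c) : ∑ i, f i * K.nodal i x ≤ c := by
  have hsf := (K.mem_cells.1 hs).1
  calc ∑ i, f i * K.nodal i x ≤ ∑ i, c * K.nodal i x := by
        refine Finset.sum_le_sum fun i _ => ?_
        by_cases hi : (i : Rn n) ∈ s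
        · exact mul_le_mul_of_nonneg_right (hf i hi) (K.nodal_nonneg i x)
        · simp [K.nodal_eq_zero_of_notMem hsf hx i hi]
    _ = c := by rw [← Finset.mul_sum, K.sum_nodal hsf hx, mul_one]

/-- The quadrature error for `z_h²` is the variance of the nodal values. -/
theorem fe_sq_sub_sq_fe {x : Rn n} (hx : x ∈ K.domain) (z : K.Node → ℝ) :
    K.fe (fun i => z i ^ 2) x - K.fe z x ^ 2 = ∑ i, (z i - K.fe z x) ^ 2 * K.nodal i x := by
  obtain ⟨s, hs, hxs⟩ := K.exists_mem_cell hx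
  have h1 := K.sum_nodal (K.mem_cells.1 hs).1 hxs
  set m := K.fe z x with hm
  have h2 : ∑ i, z i * K.nodal i x = m := rfl
  have : ∀ i, (z i - m) ^ 2 * K.nodal i x =
      z i ^ 2 * K.nodal i x - 2 * m * (z i * K.nodal i x) + m ^ 2 * K.nodal i x := fun i => by ring
  simp_rw [this, Finset.sum_add_distrib, Finset.sum_sub_distrib, ← Finset.mul_sum, h1, h2, fe]
  ring

theorem fe_sq_sub_sq_fe_nonneg {x : Rn n} (hx : x ∈ K.domain) (z : K.Node → ℝ) :
    0 ≤ K.fe (fun i => z i ^ 2) x - K.fe z x ^ 2 := by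
  rw [K.fe_sq_sub_sq_fe hx]
  exact Finset.sum_nonneg fun i _ => mul_nonneg (sq_nonneg _) (K.nodal_nonneg i x)

theorem fe_abs_sub_abs_fe_nonneg (x : Rn n) (z : K.Node → ℝ) :
    0 ≤ K.fe (fun i => |z i|) x - |K.fe z x| := by
  rw [sub_nonneg]
  refine (Finset.abs_sum_le_sum_abs _ _).trans (Finset.sum_le_sum fun i _ => ?_)
  rw [abs_mul, abs_of_nonneg (K.nodal_nonneg i x)]

/-- Since the weights sum to 1, `|z_h(x)|` can be moved under the sum; the reverse triangle
inequality then applies to each term. -/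
theorem fe_abs_sub_abs_fe_le {x : Rn n} (hx : x ∈ K.domain) (z : K.Node → ℝ) :
    K.fe (fun i => |z i|) x - |K.fe z x| ≤ ∑ i, |z i - K.fe z x| * K.nodal i x := by
  obtain ⟨s, hs, hxs⟩ := K.exists_mem_cell hx
  have h1 := K.sum_nodal (K.mem_cells.1 hs).1 hxs
  calc K.fe (fun i => |z i|) x - |K.fe z x|
      = ∑ i, (|z i| - |K.fe z x|) * K.nodal i x := by
        simp_rw [sub_mul, Finset.sum_sub_distrib, ← Finset.mul_sum, h1, mul_one]; rfl
    _ ≤ _ := Finset.sum_le_sum fun i _ =>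
        mul_le_mul_of_nonneg_right (abs_sub_abs_le_abs_sub _ _) (K.nodal_nonneg i x)

/-! ### Lumping errors as integrals of Jensen gaps -/

theorem matNormSq_lumped_sub_mass (z : K.Node → ℝ) :
    matNormSq K.lumpedMassMatrix z - matNormSq K.massMatrix z =
      ∫ x in K.domain, (K.fe (fun i => z i ^ 2) x - K.fe z x ^ 2) := by
  classical
  have hW : matNormSq K.lumpedMassMatrix z = ∫ x in K.domain, K.fe (fun i => z i ^ 2) x := by
    simp only [fe]
    rw [integral_finsetSum _ fun i _ =>
      (K.integrableOn_domain (K.continuousOn_nodal i)).const_mul (z i ^ 2)]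
    simp only [matNormSq, dotProduct, lumpedMassMatrix, Matrix.mulVec_diagonal, integral_const_mul]
    exact Finset.sum_congr rfl fun i _ => by ring
  have hM : matNormSq K.massMatrix z = ∫ x in K.domain, K.fe z x ^ 2 := by
    have hI : ∀ i j, IntegrableOn (fun x => z i * z j * (K.nodal i x * K.nodal j x)) K.domain :=
      fun i j => K.integrableOn_domain
        (continuousOn_const.mul ((K.continuousOn_nodal i).mul (K.continuousOn_nodal j)))
    have : ∀ x, K.fe z x ^ 2 = ∑ i, ∑ j, z i * z j * (K.nodal i x * K.nodal j x) := fun x => by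
      rw [sq, fe, Finset.sum_mul_sum]
      exact Finset.sum_congr rfl fun i _ => Finset.sum_congr rfl fun j _ => by ring
    simp_rw [this]
    rw [integral_finsetSum _ fun i _ => integrable_finsetSum _ fun j _ => hI i j]
    simp only [matNormSq, dotProduct, Matrix.mulVec, Finset.mul_sum]
    refine Finset.sum_congr rfl fun i _ => ?_
    rw [integral_finsetSum _ fun j _ => hI i j]
    refine Finset.sum_congr rfl fun j _ => ?_
    rw [integral_const_mul]
    simp only [massMatrix, Matrix.of_apply]
    ring
  rw [hW, hM]
  exact (integral_sub (K.integrableOn_domain (K.continuousOn_fe _))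
    (K.integrableOn_domain ((K.continuousOn_fe z).pow 2))).symm

theorem l1Norm_lumped_sub_integral (z : K.Node → ℝ) :
    l1Norm (K.lumpedMassMatrix *ᵥ z) - ∫ x in K.domain, |K.fe z x| =
      ∫ x in K.domain, (K.fe (fun i => |z i|) x - |K.fe z x|) := by
  classical
  rw [integral_sub (K.integrableOn_domain (K.continuousOn_fe _))
    (K.integrableOn_domain (K.continuousOn_fe z).abs)]
  congr 1
  simp only [fe]
  rw [integral_finsetSum _ fun i _ =>
    (K.integrableOn_domain (K.continuousOn_nodal i)).const_mul |z i|]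
  simp only [l1Norm, lumpedMassMatrix, Matrix.mulVec_diagonal, integral_const_mul, abs_mul]
  refine Finset.sum_congr rfl fun i _ => ?_
  rw [abs_of_nonneg (integral_nonneg fun x => K.nodal_nonneg i x), mul_comm]

end Triangulation

/-! ### Weak derivatives, Cauchy–Schwarz and infima -/

/-- On an open subset where `f` agrees with a `C¹` function, every weak partial derivative of `f` is
the classical one. -/
theorem IsWeakPartial.ae_eq_fderiv {n : ℕ} {U V : Set (Rn n)} {i : Fin n} {f g F : Rn n → ℝ}
    (h : IsWeakPartial U i f g) (hV : IsOpen V) (hVU : V ⊆ U) (hF : ContDiff ℝ 1 F)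
    (hfF : ∀ᵐ x : Rn n, x ∈ V → f x = F x) :
    ∀ᵐ x : Rn n, x ∈ V → g x = fderiv ℝ F x (EuclideanSpace.single i 1) := by
  obtain ⟨-, hg, hw⟩ := h
  have hF' : Continuous fun x => fderiv ℝ F x (EuclideanSpace.single i 1) :=
    (hF.continuous_fderiv one_ne_zero).clm_apply continuous_const
  have hloc : LocallyIntegrableOn
      (fun x => g x - fderiv ℝ F x (EuclideanSpace.single i 1)) V volume :=
    (hg.mono_set hVU).sub (hF'.locallyIntegrable.locallyIntegrableOn V)
  -- Fundamental lemma of the calculus of variations on `V`: it remains to test the difference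
  -- against smooth functions supported in `V`.
  have key := hV.ae_eq_zero_of_integral_contDiff_smul_eq_zero hloc ?_
  · filter_upwards [key] with x hx hxV using sub_eq_zero.1 (hx hxV)
  intro ψ hψ hψc hψV
  have hψ0 : ∀ x ∉ V, ψ x = 0 := fun x hx => image_eq_zero_of_notMem_tsupport fun h => hx (hψV h)
  have hψ' : Continuous fun x => fderiv ℝ ψ x (EuclideanSpace.single i 1) :=
    (hψ.continuous_fderiv (by simp)).clm_apply continuous_const
  have hψ'c : HasCompactSupport fun x => fderiv ℝ ψ x (EuclideanSpace.single i 1) :=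
    hψc.fderiv_apply (𝕜 := ℝ) _
  have hψ'0 : ∀ x ∉ V, fderiv ℝ ψ x (EuclideanSpace.single i 1) = 0 := fun x hx => by
    rw [fderiv_of_notMem_tsupport ℝ fun h => hx (hψV h)]; rfl
  have hgψ : Integrable fun x => g x * ψ x := by
    rw [← integrableOn_iff_integrable_of_support_subset (s := tsupport ψ)]
    · exact (hg.integrableOn_compact_subset (hψV.trans hVU) hψc).mul_continuousOn
        hψ.continuous.continuousOn hψc
    · exact fun x hx => subset_tsupport ψ (right_ne_zero_of_mul hx)
  have hF'ψ : Integrable fun x => fderiv ℝ F x (EuclideanSpace.single i 1) * ψ x :=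
    (hF'.mul hψ.continuous).integrable_of_hasCompactSupport hψc.mul_left
  have e1 := hw ψ hψ hψc (hψV.trans hVU)
  -- The integrands vanish off `V`, so the integrals extend to the whole space, where integration by
  -- parts with `F` has no boundary term.
  rw [setIntegral_eq_integral_of_forall_compl_eq_zero
      (fun x hx => by rw [hψ'0 x fun h => hx (hVU h), mul_zero]),
    setIntegral_eq_integral_of_forall_compl_eq_zero
      (fun x hx => by rw [hψ0 x fun h => hx (hVU h), mul_zero])] at e1
  have e2 : ∫ x, f x * fderiv ℝ ψ x (EuclideanSpace.single i 1) =
      ∫ x, F x * fderiv ℝ ψ x (EuclideanSpace.single i 1) := by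
    refine integral_congr_ae ?_
    filter_upwards [hfF] with x hx
    by_cases hxV : x ∈ V
    · rw [hx hxV]
    · simp [hψ'0 x hxV]
  have e3 := integral_mul_fderiv_eq_neg_fderiv_mul_of_integrable (μ := volume) hF'ψ
    ((hF.continuous.mul hψ').integrable_of_hasCompactSupport hψ'c.mul_left)
    ((hF.continuous.mul hψ.continuous).integrable_of_hasCompactSupport hψc.mul_left)
    (fun x _ => hF.differentiable one_ne_zero x)
    (fun x _ => hψ.differentiable (by simp) x)
  have e4 : ∀ x, ψ x • (g x - fderiv ℝ F x (EuclideanSpace.single i 1)) =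
      g x * ψ x - fderiv ℝ F x (EuclideanSpace.single i 1) * ψ x := fun x => by
    rw [smul_eq_mul]; ring
  simp_rw [e4]
  rw [integral_sub hgψ hF'ψ]
  linarith

theorem opNorm_sq_le_sum_sq {n : ℕ} (a : Rn n →L[ℝ] ℝ) :
    ‖a‖ ^ 2 ≤ ∑ i, a (EuclideanSpace.single i 1) ^ 2 := by
  have h0 : 0 ≤ ∑ i, a (EuclideanSpace.single i 1) ^ 2 := Finset.sum_nonneg fun i _ => sq_nonneg _
  rw [← Real.le_sqrt (norm_nonneg _) h0]
  refine a.opNorm_le_bound (Real.sqrt_nonneg _) fun y => ?_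
  have hy : a y = ∑ i, a (EuclideanSpace.single i 1) * y i := by
    conv_lhs => rw [← (EuclideanSpace.basisFun (Fin n) ℝ).sum_repr y]
    simp [mul_comm]
  rw [hy, EuclideanSpace.norm_eq, ← Real.sqrt_mul h0, Real.norm_eq_abs]
  refine Real.abs_le_sqrt ?_
  simpa using Finset.sum_mul_sq_le_sq_mul_sq Finset.univ
    (fun i => a (EuclideanSpace.single i 1)) (fun i => y i)

theorem opNorm_le_sum_abs {n : ℕ} (a : Rn n →L[ℝ] ℝ) :
    ‖a‖ ≤ ∑ i, |a (EuclideanSpace.single i 1)| := by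
  have h0 : 0 ≤ ∑ i, |a (EuclideanSpace.single i 1)| := Finset.sum_nonneg fun i _ => abs_nonneg _
  refine (sq_le_sq₀ (norm_nonneg _) h0).1 ((opNorm_sq_le_sum_sq a).trans ?_)
  simp_rw [← sq_abs (a _)]
  exact Finset.sum_sq_le_sq_sum_of_nonneg fun i _ => abs_nonneg _

theorem l2NormSq_rpow_half {n : ℕ} (V : Set (Rn n)) (f : Rn n → ℝ) :
    l2NormSq V f ^ (1 / 2 : ℝ) = eLpNorm f 2 (volume.restrict V) := by
  rw [l2NormSq, ← ENNReal.rpow_natCast, ← ENNReal.rpow_mul]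
  norm_num

theorem lintegral_enorm_le_l2NormSq {n : ℕ} {V : Set (Rn n)} {f : Rn n → ℝ}
    (hf : AEStronglyMeasurable f (volume.restrict V)) :
    ∫⁻ x in V, ‖f x‖ₑ ≤ volume V ^ (1 / 2 : ℝ) * l2NormSq V f ^ (1 / 2 : ℝ) := by
  have h := eLpNorm_le_eLpNorm_mul_rpow_measure_univ (p := 1) (q := 2) one_le_two hf
  rw [eLpNorm_one_eq_lintegral_enorm, Measure.restrict_apply_univ] at h
  rw [l2NormSq_rpow_half, mul_comm]
  refine h.trans_eq ?_
  norm_num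

/-- Integrated form of a pointwise bound by a sum of `L²` functions. -/
theorem lintegral_ofReal_le_of_le_sum_abs {n : ℕ} {V : Set (Rn n)} (hV : MeasurableSet V)
    {u : Rn n → ℝ} {G : Fin n → Rn n → ℝ} {c : ℝ} (hc : 0 ≤ c) {T : ℝ≥0∞}
    (hG : ∀ i, AEStronglyMeasurable (G i) (volume.restrict V))
    (hT : ∀ i, l2NormSq V (G i) ≤ T)
    (hu : ∀ᵐ x : Rn n, x ∈ V → u x ≤ c * ∑ i, |G i x|) :
    ∫⁻ x in V, ENNReal.ofReal (u x) ≤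
      ENNReal.ofReal c * n * volume V ^ (1 / 2 : ℝ) * T ^ (1 / 2 : ℝ) := by
  calc ∫⁻ x in V, ENNReal.ofReal (u x)
      ≤ ∫⁻ x in V, ENNReal.ofReal c * ∑ i, ‖G i x‖ₑ := by
        refine lintegral_mono_ae ?_
        rw [ae_restrict_iff' hV]
        filter_upwards [hu] with x hx hxV
        refine (ENNReal.ofReal_le_ofReal (hx hxV)).trans_eq ?_
        rw [ENNReal.ofReal_mul hc, ENNReal.ofReal_sum_of_nonneg fun i _ => abs_nonneg _]
        simp_rw [Real.enorm_eq_ofReal_abs]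
    _ = ENNReal.ofReal c * ∑ i, ∫⁻ x in V, ‖G i x‖ₑ := by
        rw [lintegral_const_mul' _ _ ENNReal.ofReal_ne_top,
          lintegral_finsetSum' _ fun i _ => (hG i).enorm]
    _ ≤ ENNReal.ofReal c * ∑ _i : Fin n, volume V ^ (1 / 2 : ℝ) * T ^ (1 / 2 : ℝ) := by
        gcongr with i
        exact (lintegral_enorm_le_l2NormSq (hG i)).trans (by gcongr; exact hT i)
    _ = _ := by
        rw [Finset.sum_const, Finset.card_univ, Fintype.card_fin, nsmul_eq_mul]
        ring

/-- Dividing by `c` moves it past the infimum. Excluding `c = 0` matters: the infimum may be `⊤`,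
and `0 * ⊤ = 0`. -/
theorem le_mul_h1Norm {n : ℕ} {U : Set (Rn n)} {f : Rn n → ℝ} {A c : ℝ≥0∞} (hc : c ≠ 0)
    (hc' : c ≠ ⊤)
    (h : ∀ g : Fin n → Rn n → ℝ, (∀ i, IsWeakPartial U i f (g i)) →
      A ≤ c * (l2NormSq U f + ∑ i, l2NormSq U (g i)) ^ (1 / 2 : ℝ)) :
    A ≤ c * h1Norm U f := by
  rw [mul_comm, ← ENNReal.div_le_iff hc hc']
  refine le_iInf₂ fun g hg => ?_
  rw [ENNReal.div_le_iff hc hc', mul_comm]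
  exact h g hg

theorem le_mul_h2Norm {n : ℕ} {U : Set (Rn n)} {f : Rn n → ℝ} {A c : ℝ≥0∞} (hc : c ≠ 0)
    (hc' : c ≠ ⊤)
    (h : ∀ g : Fin n → Rn n → ℝ, (∀ i, IsWeakPartial U i f (g i)) →
      ∀ H : Fin n → Fin n → Rn n → ℝ, (∀ i j, IsWeakPartial U j (g i) (H i j)) →
      A ≤ c * (l2NormSq U f + ∑ i, l2NormSq U (g i) + ∑ i, ∑ j, l2NormSq U (H i j)) ^
        (1 / 2 : ℝ)) :
    A ≤ c * h2Norm U f := by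
  rw [mul_comm, ← ENNReal.div_le_iff hc hc']
  refine le_iInf₂ fun g hg => le_iInf₂ fun H hH => ?_
  rw [ENNReal.div_le_iff hc hc', mul_comm]
  exact h g hg H hH

/-! ### Integrated estimates on open subsets and over the cells -/

namespace Triangulation

variable {n : ℕ} (K : Triangulation n)

theorem meshSize_pos (hn : 0 < n) : 0 < K.meshSize := by
  obtain ⟨s, hs⟩ := K.nonempty_faces
  obtain ⟨t, ht, -, hc⟩ := K.pure_faces s hs
  obtain ⟨x, hx, y, hy, hxy⟩ := Finset.one_lt_card.1 (show 1 < t.card by omega)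
  exact (dist_pos.2 hxy).trans_le (K.dist_le_meshSize (K.mem_cells.2 ⟨ht, hc⟩)
    (subset_convexHull ℝ _ hx) (subset_convexHull ℝ _ hy))

theorem volume_ne_top {V : Set (Rn n)} (hVD : V ⊆ K.domain) : volume V ≠ ⊤ :=
  ne_top_of_le_ne_top K.isCompact_space.measure_lt_top.ne
    (measure_mono (hVD.trans interior_subset))

theorem ae_fe_abs_sub_abs_fe_le {V : Set (Rn n)} (hV : IsOpen V) (hVD : V ⊆ K.domain)
    (z : K.Node → ℝ) {g : Fin n → Rn n → ℝ} (hg : ∀ i, IsWeakPartial V i (K.fe z) (g i)) :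
    ∀ᵐ x : Rn n, x ∈ V →
      K.fe (fun i => |z i|) x - |K.fe z x| ≤ K.meshSize * ∑ i, |g i x| := by
  have hcell : ∀ᵐ x : Rn n, ∀ s ∈ K.cells, x ∈ V ∩ interior (convexHull ℝ (s : Set (Rn n))) →
      K.fe (fun i => |z i|) x - |K.fe z x| ≤ K.meshSize * ∑ i, |g i x| := by
    rw [Finset.eventually_all]
    intro s hs
    obtain ⟨a, b, hab⟩ := K.exists_fe_eq_affine hs z
    have hga : ∀ᵐ x : Rn n, ∀ i, x ∈ V ∩ interior (convexHull ℝ (s : Set (Rn n))) →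
        g i x = a (EuclideanSpace.single i 1) := by
      refine ae_all_iff.2 fun i => ?_
      have := (hg i).ae_eq_fderiv (F := fun x => a x + b) (hV.inter isOpen_interior)
        inter_subset_left (a.contDiff.add contDiff_const)
        (.of_forall fun x hx => hab x (interior_subset hx.2))
      filter_upwards [this] with x hx hxs
      rw [hx hxs, (a.hasFDerivAt.add_const b).fderiv]
    filter_upwards [hga] with x hx hxs
    have hxs' := interior_subset hxs.2
    calc K.fe (fun i => |z i|) x - |K.fe z x| ≤ ∑ i, |z i - K.fe z x| * K.nodal i x :=
          K.fe_abs_sub_abs_fe_le (hVD hxs.1) z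
      _ ≤ ‖a‖ * K.meshSize := K.sum_nodal_mul_le hs hxs' (K.abs_node_sub_fe_le hs z hab hxs')
      _ ≤ K.meshSize * ∑ i, |g i x| := by
          rw [mul_comm]
          simp_rw [hx _ hxs]
          exact mul_le_mul_of_nonneg_left (opNorm_le_sum_abs a) K.meshSize_nonneg
  filter_upwards [hcell, K.ae_exists_mem_interior_cell] with x h1 h2 hxV
  obtain ⟨s, hs, hxs⟩ := h2 (hVD hxV)
  exact h1 s hs ⟨hxV, hxs⟩

theorem ae_fe_sq_sub_sq_fe_le {V : Set (Rn n)} (hV : IsOpen V) (hVD : V ⊆ K.domain)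
    (z : K.Node → ℝ) {g : Fin n → Rn n → ℝ}
    (hg : ∀ i, IsWeakPartial V i (fun x => K.fe z x ^ 2) (g i))
    {H : Fin n → Fin n → Rn n → ℝ} (hH : ∀ i j, IsWeakPartial V j (g i) (H i j)) :
    ∀ᵐ x : Rn n, x ∈ V →
      K.fe (fun i => z i ^ 2) x - K.fe z x ^ 2 ≤ K.meshSize ^ 2 * ∑ i, |H i i x| := by
  have hcell : ∀ᵐ x : Rn n, ∀ s ∈ K.cells, x ∈ V ∩ interior (convexHull ℝ (s : Set (Rn n))) →
      K.fe (fun i => z i ^ 2) x - K.fe z x ^ 2 ≤ K.meshSize ^ 2 * ∑ i, |H i i x| := by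
    rw [Finset.eventually_all]
    intro s hs
    obtain ⟨a, b, hab⟩ := K.exists_fe_eq_affine hs z
    have hHa : ∀ᵐ x : Rn n, ∀ i, x ∈ V ∩ interior (convexHull ℝ (s : Set (Rn n))) →
        H i i x = 2 * a (EuclideanSpace.single i 1) ^ 2 := by
      refine ae_all_iff.2 fun i => ?_
      have hd : ∀ x, HasFDerivAt (fun x => a x + b) a x := fun x => a.hasFDerivAt.add_const b
      have hc : ContDiff ℝ 1 fun x => a x + b := a.contDiff.add contDiff_const
      have h1 := (hg i).ae_eq_fderiv (F := fun x => (a x + b) ^ 2) (hV.inter isOpen_interior)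
        inter_subset_left (hc.pow 2)
        (.of_forall fun x hx => by rw [hab x (interior_subset hx.2)])
      -- By `h1`, `g i` agrees almost everywhere on this set with a `C¹` function, so the
      -- identification can be applied a second time.
      have h2 := (hH i i).ae_eq_fderiv
        (F := fun x => (a x + b) * (2 * a (EuclideanSpace.single i 1)))
        (hV.inter isOpen_interior) inter_subset_left (hc.mul contDiff_const) (by
          filter_upwards [h1] with x hx hxs
          rw [hx hxs, ((hd x).pow 2).fderiv]
          simp
          ring)
      filter_upwards [h2] with x hx hxs
      rw [hx hxs, ((hd x).mul_const _).fderiv]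
      simp
      ring
    filter_upwards [hHa] with x hx hxs
    have hxs' := interior_subset hxs.2
    calc K.fe (fun i => z i ^ 2) x - K.fe z x ^ 2 = ∑ i, (z i - K.fe z x) ^ 2 * K.nodal i x :=
          K.fe_sq_sub_sq_fe (hVD hxs.1) z
      _ ≤ (‖a‖ * K.meshSize) ^ 2 := K.sum_nodal_mul_le hs hxs' fun i hi =>
          sq_le_sq.2 ((K.abs_node_sub_fe_le hs z hab hxs' i hi).trans (le_abs_self _))
      _ = K.meshSize ^ 2 * ‖a‖ ^ 2 := by ring
      _ ≤ K.meshSize ^ 2 * ∑ i, |H i i x| := by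
          refine mul_le_mul_of_nonneg_left ((opNorm_sq_le_sum_sq a).trans ?_) (sq_nonneg _)
          refine Finset.sum_le_sum fun i _ => ?_
          rw [hx i hxs, abs_of_nonneg (by positivity)]
          -- The factor 2 in `2 a_i²` is discarded.
          linarith [sq_nonneg (a (EuclideanSpace.single i 1))]
  filter_upwards [hcell, K.ae_exists_mem_interior_cell] with x h1 h2 hxV
  obtain ⟨s, hs, hxs⟩ := h2 (hVD hxV)
  exact h1 s hs ⟨hxV, hxs⟩

theorem lintegral_fe_abs_sub_abs_fe_le (hn : 0 < n) {V : Set (Rn n)} (hV : IsOpen V)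
    (hVD : V ⊆ K.domain) (z : K.Node → ℝ) :
    ∫⁻ x in V, ENNReal.ofReal (K.fe (fun i => |z i|) x - |K.fe z x|) ≤
      ENNReal.ofReal K.meshSize * n * volume V ^ (1 / 2 : ℝ) * h1Norm V (K.fe z) := by
  -- On a null set the constant would be 0, which the passage to the infimum excludes.
  by_cases hV0 : volume V = 0
  · simp [Measure.restrict_eq_zero.2 hV0]
  refine le_mul_h1Norm ?_ ?_ fun g hg => ?_
  · simp [K.meshSize_pos hn, hn.ne', hV0]
  · finiteness [K.volume_ne_top hVD]
  · refine lintegral_ofReal_le_of_le_sum_abs hV.measurableSet K.meshSize_nonneg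
      (fun i => (hg i).2.1.aestronglyMeasurable) (fun i => ?_)
      (K.ae_fe_abs_sub_abs_fe_le hV hVD z hg)
    exact (Finset.single_le_sum (f := fun i => l2NormSq V (g i)) (fun _ _ => zero_le)
      (Finset.mem_univ i)).trans le_add_self

theorem lintegral_fe_sq_sub_sq_fe_le (hn : 0 < n) {V : Set (Rn n)} (hV : IsOpen V)
    (hVD : V ⊆ K.domain) (z : K.Node → ℝ) :
    ∫⁻ x in V, ENNReal.ofReal (K.fe (fun i => z i ^ 2) x - K.fe z x ^ 2) ≤
      ENNReal.ofReal (K.meshSize ^ 2) * n * volume V ^ (1 / 2 : ℝ) *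
        h2Norm V (fun x => K.fe z x ^ 2) := by
  by_cases hV0 : volume V = 0
  · simp [Measure.restrict_eq_zero.2 hV0]
  refine le_mul_h2Norm ?_ ?_ fun g hg H hH => ?_
  · simp [(K.meshSize_pos hn).ne', hn.ne', hV0]
  · finiteness [K.volume_ne_top hVD]
  · refine lintegral_ofReal_le_of_le_sum_abs (G := fun i => H i i) hV.measurableSet (sq_nonneg _)
      (fun i => (hH i i).2.1.aestronglyMeasurable) (fun i => ?_)
      (K.ae_fe_sq_sub_sq_fe_le hV hVD z hg hH)
    calc l2NormSq V (H i i) ≤ ∑ j, l2NormSq V (H i j) :=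
          Finset.single_le_sum (f := fun j => l2NormSq V (H i j)) (fun _ _ => zero_le)
            (Finset.mem_univ i)
      _ ≤ ∑ i, ∑ j, l2NormSq V (H i j) :=
          Finset.single_le_sum (f := fun i => ∑ j, l2NormSq V (H i j)) (fun _ _ => zero_le)
            (Finset.mem_univ i)
      _ ≤ _ := le_add_self

theorem sum_volume_interior_cells_le :
    ∑ s ∈ K.cells, volume (interior (convexHull ℝ (s : Set (Rn n)))) ≤ volume K.domain := by
  rw [← measure_biUnion_finset K.pairwiseDisjoint_interior_cells
    fun s _ => isOpen_interior.measurableSet]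
  exact measure_mono (iUnion₂_subset fun s hs => K.interior_cell_subset_domain hs)

theorem lintegral_domain_eq_sum (f : Rn n → ℝ≥0∞) :
    ∫⁻ x in K.domain, f x =
      ∑ s ∈ K.cells, ∫⁻ x in interior (convexHull ℝ (s : Set (Rn n))), f x := by
  rw [← lintegral_biUnion_finset K.pairwiseDisjoint_interior_cells
    fun s _ => isOpen_interior.measurableSet]
  refine setLIntegral_congr ?_
  filter_upwards [K.ae_exists_mem_interior_cell] with x hx
  refine propext ⟨fun h => ?_, fun h => ?_⟩
  · obtain ⟨s, hs, hxs⟩ := hx h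
    exact mem_iUnion₂.2 ⟨s, hs, hxs⟩
  · obtain ⟨s, hs, hxs⟩ := mem_iUnion₂.1 h
    exact K.interior_cell_subset_domain hs hxs

/-- The cellwise estimates carry factors `|T|^{1/2}`. Cauchy–Schwarz over the cells collects them
into `(∑ |T|)^{1/2}`, at most `|Ω_h|^{1/2}` because the interiors are disjoint. -/
theorem lintegral_fe_sq_sub_sq_fe_le_broken (hn : 0 < n) (z : K.Node → ℝ) :
    ∫⁻ x in K.domain, ENNReal.ofReal (K.fe (fun i => z i ^ 2) x - K.fe z x ^ 2) ≤
      ENNReal.ofReal (K.meshSize ^ 2) * n * volume K.domain ^ (1 / 2 : ℝ) *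
        K.brokenH2Norm (fun x => K.fe z x ^ 2) := by
  rw [lintegral_domain_eq_sum]
  set T : Finset (Rn n) → Set (Rn n) := fun s => interior (convexHull ℝ (s : Set (Rn n)))
  set N : Finset (Rn n) → ℝ≥0∞ := fun s => h2Norm (T s) (fun x => K.fe z x ^ 2)
  have hCS := ENNReal.inner_le_Lp_mul_Lq K.cells (fun s => volume (T s) ^ (1 / 2 : ℝ)) N
    Real.HolderConjugate.two_two
  simp_rw [← ENNReal.rpow_mul] at hCS
  norm_num at hCS
  calc ∑ s ∈ K.cells, ∫⁻ x in T s, ENNReal.ofReal (K.fe (fun i => z i ^ 2) x - K.fe z x ^ 2)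
      ≤ ∑ s ∈ K.cells,
          ENNReal.ofReal (K.meshSize ^ 2) * n * (volume (T s) ^ (1 / 2 : ℝ) * N s) := by
        refine Finset.sum_le_sum fun s hs => ?_
        rw [← mul_assoc]
        exact K.lintegral_fe_sq_sub_sq_fe_le hn isOpen_interior
          (K.interior_cell_subset_domain hs) z
    _ = ENNReal.ofReal (K.meshSize ^ 2) * n *
          ∑ s ∈ K.cells, volume (T s) ^ (1 / 2 : ℝ) * N s := by rw [Finset.mul_sum]
    _ ≤ ENNReal.ofReal (K.meshSize ^ 2) * n *
          (volume K.domain ^ (1 / 2 : ℝ) * (∑ s ∈ K.cells, N s ^ 2) ^ (1 / 2 : ℝ)) := by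
        gcongr
        refine hCS.trans ?_
        gcongr
        exact K.sum_volume_interior_cells_le
    _ = _ := by rw [← mul_assoc]; rfl

end Triangulation

end LumpedMass

/-! ### Choice of the constant and conclusion -/

theorem proposition3p2 (n : ℕ) (hn : n = 2 ∨ n = 3)
    (Ω : Set (LumpedMass.Rn n)) (hopen : IsOpen Ω) (hconv : Convex ℝ Ω)
    (hbdd : Bornology.IsBounded Ω) (hne : Ω.Nonempty)
    (κ τ : ℝ) (hκ : 0 < κ) (hτ : 0 < τ) :
    ∃ C : ℝ, 0 < C ∧ ∀ K : LumpedMass.Triangulation n,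
      K.domain ⊆ Ω → K.IsRegularQuasiUniform κ τ → ∀ z : K.Node → ℝ,
        (0 ≤ LumpedMass.matNormSq K.lumpedMassMatrix z - LumpedMass.matNormSq K.massMatrix z ∧
          ENNReal.ofReal
              (LumpedMass.matNormSq K.lumpedMassMatrix z - LumpedMass.matNormSq K.massMatrix z)
            ≤ ENNReal.ofReal C * K.brokenH2Norm (fun x => K.fe z x ^ 2)
                * ENNReal.ofReal (K.meshSize ^ 2) ∧
          ENNReal.ofReal
              (LumpedMass.matNormSq K.lumpedMassMatrix z - LumpedMass.matNormSq K.massMatrix z)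
            ≤ ENNReal.ofReal C * LumpedMass.h2Norm K.domain (fun x => K.fe z x ^ 2)
                * ENNReal.ofReal (K.meshSize ^ 2)) ∧
        (0 ≤ LumpedMass.l1Norm (K.lumpedMassMatrix *ᵥ z) - ∫ x in K.domain, |K.fe z x| ∧
          ENNReal.ofReal
              (LumpedMass.l1Norm (K.lumpedMassMatrix *ᵥ z) - ∫ x in K.domain, |K.fe z x|)
            ≤ ENNReal.ofReal C * LumpedMass.h1Norm K.domain (K.fe z)
                * ENNReal.ofReal K.meshSize) := by
  have hn0 : 0 < n := by omega
  have hvol : volume Ω ≠ ⊤ := hbdd.measure_lt_top.ne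
  set B : ℝ≥0∞ := n * volume Ω ^ (1 / 2 : ℝ) with hB
  have hBtop : B ≠ ⊤ := by rw [hB]; finiteness
  -- `B = n |Ω|^{1/2}` dominates the Cauchy–Schwarz factor of every discrete domain inside `Ω`;
  -- adding 1 makes positivity immediate.
  refine ⟨B.toReal + 1, by positivity, fun K hK _ z => ?_⟩
  have hBC : n * volume K.domain ^ (1 / 2 : ℝ) ≤ ENNReal.ofReal (B.toReal + 1) :=
    calc n * volume K.domain ^ (1 / 2 : ℝ) ≤ B := by rw [hB]; gcongr
      _ = ENNReal.ofReal B.toReal := (ENNReal.ofReal_toReal hBtop).symm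
      _ ≤ _ := ENNReal.ofReal_le_ofReal (by linarith)
  have hfinal : ∀ {A h N : ℝ≥0∞}, A ≤ h * n * volume K.domain ^ (1 / 2 : ℝ) * N →
      A ≤ ENNReal.ofReal (B.toReal + 1) * N * h := fun {A h N} hA =>
    calc A ≤ h * n * volume K.domain ^ (1 / 2 : ℝ) * N := hA
      _ = n * volume K.domain ^ (1 / 2 : ℝ) * N * h := by ring
      _ ≤ _ := by gcongr
  have hD : IsOpen K.domain := isOpen_interior
  have hsq : 0 ≤ᵐ[volume.restrict K.domain]
      fun x => K.fe (fun i => z i ^ 2) x - K.fe z x ^ 2 := by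
    filter_upwards [ae_restrict_mem hD.measurableSet] with x hx
    exact K.fe_sq_sub_sq_fe_nonneg hx z
  have habs : 0 ≤ᵐ[volume.restrict K.domain]
      fun x => K.fe (fun i => |z i|) x - |K.fe z x| :=
    .of_forall fun x => K.fe_abs_sub_abs_fe_nonneg x z
  -- Nonnegativity of the gaps turns the real integrals into the lower integrals already estimated.
  rw [K.matNormSq_lumped_sub_mass, K.l1Norm_lumped_sub_integral,
    ofReal_integral_eq_lintegral_ofReal
      (f := fun x => K.fe (fun i => z i ^ 2) x - K.fe z x ^ 2) (K.integrableOn_domain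
      ((K.continuousOn_fe _).sub ((K.continuousOn_fe z).pow 2))) hsq,
    ofReal_integral_eq_lintegral_ofReal
      (f := fun x => K.fe (fun i => |z i|) x - |K.fe z x|) (K.integrableOn_domain
      ((K.continuousOn_fe _).sub (K.continuousOn_fe z).abs)) habs]
  exact ⟨⟨integral_nonneg_of_ae hsq, hfinal (K.lintegral_fe_sq_sub_sq_fe_le_broken hn0 z),
    hfinal (K.lintegral_fe_sq_sub_sq_fe_le hn0 hD subset_rfl z)⟩,
    integral_nonneg_of_ae habs, hfinal (K.lintegral_fe_abs_sub_abs_fe_le hn0 hD subset_rfl z)⟩
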